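/- For a finite graph $G$ with $n$ vertices and $k<n$ connected components, and an integer $h\ge 1$, let $\mathrm{Lip}(G;h)$ be the set of functions $f:V(G)\to\mathbb{Z}$ with $|f(x)-f(y)|\le h$ for every edge $\{x,y\}$ of $G$ and with $f=0$ at one fixed vertex in each connected component (the cardinality does not depend on the choice of these vertices). Let $$c(G)=\lim_{h\to\infty}\frac1h\,|\mathrm{Lip}(G;h)|^{1/(n-k)} .$$ Let $L_{m,n}$ be the $m\times n$ grid graph, that is, the Cartesian product of a path with $m$ vertices and a path with $n$ vertices. Theorem. For every $n\ge 2$ the limit defining $c(L_{n,n})$ exists, the limit $\lim_{n\to\infty}c(L_{n,n})$ exists, and $$\lim_{n\to\infty}c(L_{n,n})\le\frac{1}{\arctan(3/4)},$$ where $1/\arctan(3/4)\approx 1.554$, with an error of less than $0.0005$. -/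

import Mathlib

open Filter Topology

namespace LipGraph

/-- The integer-valued `h`-Lipschitz functions on the vertices of `G` (they change by at most `h`
along every edge) which vanish at the chosen vertex `r C` of each connected component `C`. -/
def Lip {V : Type*} (G : SimpleGraph V) (r : G.ConnectedComponent → V) (h : ℕ) : Set (V → ℤ) :=
  {f | (∀ C, f (r C) = 0) ∧ ∀ x y, G.Adj x y → |f x - f y| ≤ (h : ℤ)}

/-- The number `|Lip(G; h)|`, computed with one choice of a vertex in each component. By
`ncard_lip_eq_lipCount` below it does not depend on this choice. -/
noncomputable def lipCount {V : Type*} (G : SimpleGraph V) (h : ℕ) : ℕ :=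
  (Lip G (fun C => Quot.out C) h).ncard

/-- On a finite graph there are only finitely many such functions. -/
theorem finite_lip {V : Type*} [Finite V] (G : SimpleGraph V) (r : G.ConnectedComponent → V)
    (hr : ∀ C, G.connectedComponentMk (r C) = C) (h : ℕ) : (Lip G r h).Finite := by
  have key : ∀ f ∈ Lip G r h, ∀ x y : V, ∀ w : G.Walk x y, |f x - f y| ≤ (h : ℤ) * w.length := by
    intro f hf x y w
    induction w with
    | nil => simp
    | @cons a b c hab p ih =>
      have h1 := hf.2 a b hab
      have h2 := abs_sub_le (f a) (f b) (f c)
      rw [SimpleGraph.Walk.length_cons]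
      push_cast
      linarith
  have hw : ∀ x : V, Nonempty (G.Walk x (r (G.connectedComponentMk x))) := fun x =>
    SimpleGraph.ConnectedComponent.exact (hr (G.connectedComponentMk x)).symm
  let B : V → ℤ := fun x => (h : ℤ) * (hw x).some.length
  refine (Set.Finite.pi' (fun x : V => Set.finite_Icc (-(B x)) (B x))).subset ?_
  intro f hf x
  have h1 := key f hf x _ (hw x).some
  rw [hf.1, sub_zero, abs_le] at h1
  exact h1

/-- The number of functions is the same for every choice of a vertex in each component. -/
theorem ncard_lip_eq_lipCount {V : Type*} (G : SimpleGraph V) (r : G.ConnectedComponent → V)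
    (hr : ∀ C, G.connectedComponentMk (r C) = C) (h : ℕ) : (Lip G r h).ncard = lipCount G h := by
  have shift : ∀ r₁ r₂ : G.ConnectedComponent → V, (∀ C, G.connectedComponentMk (r₂ C) = C) →
      ∀ f ∈ Lip G r₁ h, (fun x => f x - f (r₂ (G.connectedComponentMk x))) ∈ Lip G r₂ h := by
    intro r₁ r₂ h₂ f hf
    refine ⟨fun C => by simp [h₂], fun x y hxy => ?_⟩
    have e : G.connectedComponentMk x = G.connectedComponentMk y :=
      SimpleGraph.ConnectedComponent.sound hxy.reachable
    have h1 := hf.2 x y hxy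
    simpa [e] using h1
  have ho : ∀ C : G.ConnectedComponent, G.connectedComponentMk (Quot.out C) = C :=
    fun C => Quot.out_eq C
  unfold lipCount
  refine Set.ncard_congr (fun f _ x => f x - f (Quot.out (G.connectedComponentMk x)))
    (fun f hf => shift _ _ ho f hf) ?_ ?_
  · intro f g hf hg hfg
    funext x
    have h1 := congrFun hfg x
    have h2 := congrFun hfg (r (G.connectedComponentMk x))
    simp only [hr, hf.1, hg.1] at h1 h2
    linarith
  · intro g hg
    refine ⟨_, shift _ _ hr g hg, ?_⟩
    funext x
    simp only [ho, hg.1]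
    ring

/-- The quantity `(1 / h) * |Lip(G; h)| ^ (1 / (n - k))`, where `n` is the number of vertices and
`k` the number of connected components of `G`. -/
noncomputable def lipRatio {V : Type*} (G : SimpleGraph V) (h : ℕ) : ℝ :=
  1 / (h : ℝ) *
    (lipCount G h : ℝ) ^ (1 / ((Nat.card V : ℝ) - (Nat.card G.ConnectedComponent : ℝ)))

/-- The constant `c(G)`, the limit of `lipRatio G h` as `h → ∞` (with a junk value if there is no
limit). -/
noncomputable def lipConst {V : Type*} (G : SimpleGraph V) : ℝ :=
  limUnder atTop (lipRatio G)

/-- The `m × n` grid graph: the Cartesian product of the paths with `m` and with `n` vertices. -/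
def gridGraph (m n : ℕ) : SimpleGraph (Fin m × Fin n) :=
  (SimpleGraph.pathGraph m).boxProd (SimpleGraph.pathGraph n)

end LipGraph

/-!
The bound rests on building the grid row by row. Given one row `u`, the next row `e` satisfies
`|e i - u i| ≤ h` and is `h`-Lipschitz along a path. By rearrangement one expects most choices of
`e` when `u` is constant, and then `e` is an `h`-Lipschitz path in the window `[-h, h]`. After
rescaling, their number is governed by the integral operator with kernel `1[|x - y| ≤ 1]` on
`[-1, 1]`, whose leading eigenfunction is `cos (ω x) - sin (ω |x|) / 2` with `ω = arctan (3 / 4)` and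
eigenvalue `1 / ω`.

The rearrangement and the spectral bound are proved together. `profile h ℓ` is a discrete version of
the integral of the eigenfunction over a centred interval with `ℓ` points, and `ProfileBound` says
that the number of partial rows whose last entry lies in *any* interval of `ℓ ≤ 2 h + 1` points is
at most a fixed multiple of `profile h ℓ`. Summing over windows multiplies the bound by at most
`growth h ~ h / ω` (`ProfileBound.window_le`, which uses the trigonometric identity in
`profile_step`), and restricting to the window about the next entry of `u` preserves it
(`profileBound_of_le_indicator`). Hence `lipCount_gridGraph_succ_le`: a new row with `n` vertices
costs a factor of order `(2 / ω) * (1 / ω) ^ (n - 1) * h ^ n`.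

For each connected graph `G` the limit `c(G)` exists because `lipCount G h` counts the points of
`h⁻¹ ℤ ^ (|V| - 1)` in a convex polytope (`exists_tendsto_lipCount_div`). For the limit over the
square grids, deleting all but one of the edges between two parts of a grid shows that
`log (2 * gridVolume m n)` is subadditive in `m` and in `n`, and Fekete's lemma applies
(`exists_tendsto_diag_of_biSubadditive`).
-/

namespace LipGraph

/-! ### The eigenfunction of the transfer operator -/

theorem sin_arctan_three_div_four : Real.sin (Real.arctan (3 / 4)) = 3 / 5 := by
  rw [Real.sin_arctan, show (1 : ℝ) + (3 / 4) ^ 2 = (5 / 4) ^ 2 by norm_num,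
    Real.sqrt_sq (by norm_num)]
  norm_num

theorem cos_arctan_three_div_four : Real.cos (Real.arctan (3 / 4)) = 4 / 5 := by
  rw [Real.cos_arctan, show (1 : ℝ) + (3 / 4) ^ 2 = (5 / 4) ^ 2 by norm_num,
    Real.sqrt_sq (by norm_num)]
  norm_num

theorem arctan_three_div_four_pos : 0 < Real.arctan (3 / 4) :=
  Real.arctan_pos.2 (by norm_num)

theorem arctan_three_div_four_le : Real.arctan (3 / 4) ≤ 3 / 4 := by
  have h0 := arctan_three_div_four_pos
  have h := Real.lt_tan h0 (Real.arctan_lt_pi_div_two _)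
  rw [Real.tan_arctan] at h
  exact h.le

/-- The angle `arctan (3 / 4) / (2 h + 1)`, the frequency of `profile h` on the lattice. -/
noncomputable def angle (h : ℕ) : ℝ := Real.arctan (3 / 4) / (2 * h + 1)

/-- Up to a constant factor, `profile h ℓ` is the sum of the leading eigenfunction of the transfer
operator of a path in the window `[-h, h]` over `ℓ` consecutive integers about `0`. -/
noncomputable def profile (h ℓ : ℕ) : ℝ :=
  Real.sin (angle h * ℓ) + Real.cos (angle h * ℓ) / 2 - 1 / 2

/-- An upper bound for the growth rate of the number of `h`-Lipschitz paths in `[-h, h]`; it is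
`h / arctan (3 / 4)` to leading order. -/
noncomputable def growth (h : ℕ) : ℝ := 1 / (2 * profile h 1)

theorem angle_pos (h : ℕ) : 0 < angle h :=
  div_pos arctan_three_div_four_pos (by positivity)

theorem angle_mul_le {h ℓ : ℕ} (hl : ℓ ≤ 2 * h + 1) :
    angle h * ℓ ≤ Real.arctan (3 / 4) := by
  have h1 : (ℓ : ℝ) ≤ 2 * h + 1 := by exact_mod_cast hl
  calc angle h * ℓ ≤ angle h * (2 * h + 1) := mul_le_mul_of_nonneg_left h1 (angle_pos h).le
    _ = Real.arctan (3 / 4) := by unfold angle; field_simp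

theorem profile_full (h : ℕ) : profile h (2 * h + 1) = 1 / 2 := by
  have : angle h * ((2 * h + 1 : ℕ) : ℝ) = Real.arctan (3 / 4) := by
    unfold angle; push_cast; field_simp
  unfold profile
  rw [this, sin_arctan_three_div_four, cos_arctan_three_div_four]
  norm_num

theorem half_angle_mul_le_profile {h ℓ : ℕ} (hl : ℓ ≤ 2 * h + 1) :
    angle h / 2 * ℓ ≤ profile h ℓ := by
  rcases Nat.eq_zero_or_pos ℓ with rfl | hpos
  · simp [profile]
  have h1 := (angle_mul_le hl).trans arctan_three_div_four_le
  have h0 : 0 < angle h * ℓ := mul_pos (angle_pos h) (by exact_mod_cast hpos)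
  unfold profile
  set x := angle h * ℓ with hx
  have hs := Real.sin_gt_sub_cube h0
  have hc := Real.one_sub_sq_div_two_le_cos (x := x)
  have e : angle h / 2 * ℓ = x / 2 := by rw [hx]; ring
  rw [e]
  nlinarith [hs, hc, mul_nonneg h0.le (sub_nonneg.2 h1),
    mul_nonneg (mul_nonneg h0.le h0.le) (sub_nonneg.2 h1)]

theorem profile_one_pos (h : ℕ) : 0 < profile h 1 :=
  lt_of_lt_of_le (by simpa using angle_pos h)
    (half_angle_mul_le_profile (h := h) (ℓ := 1) (by omega))

theorem growth_pos (h : ℕ) : 0 < growth h := by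
  have := profile_one_pos h
  unfold growth; positivity

/-- The eigenvalue relation behind the choice of `profile`: it holds with equality if `growth h` is
replaced by `1 / (2 * sin (angle h))`. -/
theorem profile_step {h ℓ : ℕ} (hl : ℓ + 2 ≤ 2 * h + 1) :
    growth h * profile h ℓ + profile h (2 * h + 1) + profile h (2 * h - ℓ) ≤
      growth h * profile h (ℓ + 2) := by
  set t := angle h with ht
  set α := t * (ℓ + 1) with hα
  have hα1 : α ≤ Real.arctan (3 / 4) := by
    have := angle_mul_le (h := h) (ℓ := ℓ + 1) (by omega)
    push_cast at this
    exact this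
  have hα0 : 0 ≤ α := mul_nonneg (angle_pos h).le (by positivity)
  have e1 : profile h (2 * h + 1) + profile h (2 * h - ℓ) = Real.cos α - Real.sin α / 2 := by
    have : t * ((2 * h - ℓ : ℕ) : ℝ) = Real.arctan (3 / 4) - α := by
      rw [Nat.cast_sub (by omega), hα, ht]
      unfold angle
      push_cast
      field_simp
      ring
    rw [profile_full]
    unfold profile
    rw [← ht, this, Real.sin_sub, Real.cos_sub, sin_arctan_three_div_four,
      cos_arctan_three_div_four]
    ring
  have e2 : profile h (ℓ + 2) - profile h ℓ =
      2 * Real.sin t * (Real.cos α - Real.sin α / 2) := by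
    unfold profile
    rw [← ht, show t * ((ℓ + 2 : ℕ) : ℝ) = α + t by rw [hα]; push_cast; ring,
      show t * (ℓ : ℝ) = α - t by rw [hα]; ring, Real.sin_add, Real.sin_sub, Real.cos_add,
      Real.cos_sub]
    ring
  have e3 : 1 ≤ growth h * (2 * Real.sin t) := by
    unfold growth
    rw [one_div_mul_eq_div, one_le_div (by linarith [profile_one_pos h])]
    unfold profile
    have := Real.cos_le_one t
    simp only [Nat.cast_one, mul_one, ← ht]
    linarith
  have hc : 0 ≤ Real.cos α - Real.sin α / 2 := by
    have h1 := Real.one_sub_sq_div_two_le_cos (x := α)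
    have h2 := Real.sin_le hα0
    have h3 := hα1.trans arctan_three_div_four_le
    nlinarith
  have := mul_le_mul_of_nonneg_right e3 hc
  rw [one_mul, mul_assoc, ← e2, ← e1, mul_sub] at this
  linarith

/-! ### Rows near a given row -/

/-- The sum of `g` over the `ℓ` consecutive integers starting with `a`. -/
def intervalSum (g : ℤ → ℝ) (a : ℤ) (ℓ : ℕ) : ℝ := ∑ i ∈ Finset.range ℓ, g (a + i)

theorem intervalSum_add (g : ℤ → ℝ) (a : ℤ) (k l : ℕ) :
    intervalSum g a (k + l) = intervalSum g a k + intervalSum g (a + k) l := by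
  unfold intervalSum
  rw [Finset.sum_range_add]
  congr 1
  exact Finset.sum_congr rfl fun i _ => by push_cast; rw [add_assoc]

theorem intervalSum_mono {f g : ℤ → ℝ} (hfg : ∀ x, f x ≤ g x) (a : ℤ) (ℓ : ℕ) :
    intervalSum f a ℓ ≤ intervalSum g a ℓ :=
  Finset.sum_le_sum fun _ _ => hfg _

theorem intervalSum_nonneg {g : ℤ → ℝ} (hg : ∀ x, 0 ≤ g x) (a : ℤ) (ℓ : ℕ) :
    0 ≤ intervalSum g a ℓ :=
  Finset.sum_nonneg fun _ _ => hg _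

/-- The weight `g` on `ℤ` is, up to the factor `A`, at most as concentrated on intervals as the
leading eigenfunction in the window `[-h, h]` is on centred intervals. -/
def ProfileBound (h : ℕ) (A : ℝ) (g : ℤ → ℝ) : Prop :=
  (∀ a ℓ, ℓ ≤ 2 * h + 1 → intervalSum g a ℓ ≤ A * profile h ℓ) ∧
    ∀ a ℓ, intervalSum g a ℓ ≤ A * profile h (2 * h + 1)

/-- One step of the transfer operator. Enlarging an interval by one point at each end adds two
windows to the sum; together they cover an interval of length `2 h + ℓ + 2` and, a second time, one
of length `2 h - ℓ`. -/
theorem ProfileBound.window_le {h : ℕ} {A : ℝ} {g : ℤ → ℝ} (hA : 0 ≤ A)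
    (hg : ProfileBound h A g) (ℓ : ℕ) (hl : ℓ ≤ 2 * h + 1) (a : ℤ) :
    intervalSum (fun x => intervalSum g (x - h) (2 * h + 1)) a ℓ ≤
      A * growth h * profile h ℓ := by
  induction ℓ using Nat.twoStepInduction generalizing a with
  | zero => simp [intervalSum, profile]
  | one =>
    have h1 := hg.2 (a - h) (2 * h + 1)
    have h2 : growth h * profile h 1 = 1 / 2 := by
      have := (profile_one_pos h).ne'
      unfold growth; field_simp
    rw [mul_assoc, h2, ← profile_full h]
    simpa [intervalSum] using h1
  | more ℓ ih _ =>
    have h1 := ih (by omega) (a + 1)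
    have e : intervalSum (fun x => intervalSum g (x - h) (2 * h + 1)) a (ℓ + 1 + 1) =
        intervalSum g (a - h) (2 * h + 1) +
          intervalSum (fun x => intervalSum g (x - h) (2 * h + 1)) (a + 1) ℓ +
          intervalSum g (a - h + (ℓ + 1 : ℕ)) (2 * h + 1) := by
      rw [intervalSum_add _ _ _ 1, add_comm ℓ 1, intervalSum_add _ _ 1 ℓ]
      have e0 : ∀ (f : ℤ → ℝ) (b : ℤ), intervalSum f b 1 = f b := by simp [intervalSum]
      rw [e0, e0, show a + ((1 + ℓ : ℕ) : ℤ) - h = a - h + ((ℓ + 1 : ℕ) : ℤ) by push_cast; ring,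
        Nat.cast_one, add_comm 1 ℓ]
    -- The two new windows overlap as `ℓ + 1 ≤ 2 h`: split the left one where the right one starts.
    have e1 : intervalSum g (a - h) (2 * h + 1) =
        intervalSum g (a - h) (ℓ + 1) + intervalSum g (a - h + (ℓ + 1 : ℕ)) (2 * h - ℓ) := by
      rw [← intervalSum_add]; congr 1; omega
    have e2 := intervalSum_add g (a - h) (ℓ + 1) (2 * h + 1)
    have h2 := hg.2 (a - h) (ℓ + 1 + (2 * h + 1))
    have h3 := hg.1 (a - h + (ℓ + 1 : ℕ)) (2 * h - ℓ) (by omega)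
    have h4 := mul_le_mul_of_nonneg_left (profile_step hl) hA
    rw [show ℓ + 2 = ℓ + 1 + 1 from rfl] at h4 ⊢
    rw [e, e1]
    nlinarith

/-- Restricting a weight to a window `[u - h, u + h]` bounds its sums over long intervals. -/
theorem profileBound_of_le_indicator {h : ℕ} {A : ℝ} {g G : ℤ → ℝ} {u : ℤ} (hG : ∀ x, 0 ≤ G x)
    (hGA : ∀ ℓ, ℓ ≤ 2 * h + 1 → ∀ a, intervalSum G a ℓ ≤ A * profile h ℓ)
    (hg : ∀ x, g x ≤ if |x - u| ≤ h then G x else 0) : ProfileBound h A g := by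
  have hle : ∀ x, g x ≤ G x := fun x => (hg x).trans (by split_ifs <;> simp [hG])
  refine ⟨fun a ℓ hl => (intervalSum_mono hle a ℓ).trans (hGA ℓ hl a), fun a ℓ => ?_⟩
  refine le_trans ?_ (hGA (2 * h + 1) le_rfl (u - h))
  have himg : ∀ (f : ℤ → ℝ) (b : ℤ) (m : ℕ),
      intervalSum f b m = ∑ x ∈ (Finset.range m).image (fun i : ℕ => b + (i : ℤ)), f x := by
    intro f b m
    rw [Finset.sum_image fun i _ j _ hij => by simpa using hij]
    rfl
  refine (intervalSum_mono hg a ℓ).trans ?_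
  rw [himg, himg, ← Finset.sum_filter]
  refine Finset.sum_le_sum_of_subset_of_nonneg (fun x hx => ?_) fun x _ _ => hG x
  have h1 := (Finset.mem_filter.1 hx).2
  rw [abs_le] at h1
  exact Finset.mem_image.2 ⟨(x - (u - h)).toNat, Finset.mem_range.2 (by omega), by omega⟩

/-- The rows `e` which are `h`-Lipschitz along a path and within `h` of a given row `u`, sorted by
their last entry. -/
theorem exists_rows_profileBound (h k : ℕ) (u : Fin (k + 1) → ℤ) :
    ∃ T : ℤ → Finset (Fin (k + 1) → ℤ),
      (∀ e : Fin (k + 1) → ℤ, (∀ i, |e i - u i| ≤ h) →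
        (∀ i : Fin k, |e i.castSucc - e i.succ| ≤ h) → e ∈ T (e (Fin.last k))) ∧
      ProfileBound h (2 / angle h * growth h ^ k) fun x => ((T x).card : ℝ) := by
  classical
  have ha := angle_pos h
  have hm := growth_pos h
  induction k with
  | zero =>
    refine ⟨fun x => if |x - u 0| ≤ h then {fun _ => x} else ∅, fun e he _ => ?_, ?_⟩
    · have := he 0
      simp only [Nat.reduceAdd, Fin.last_zero, this, if_true, Finset.mem_singleton]
      funext i
      rw [Fin.fin_one_eq_zero i]
    · refine profileBound_of_le_indicator (G := fun _ => 1) (u := u 0) (by simp)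
        (fun ℓ hl a => ?_) (fun x => by dsimp only; split_ifs <;> simp)
      -- The constant `2 / angle h` is linear in `h`, as the passage to volumes requires.
      have h1 := half_angle_mul_le_profile hl
      have h2 : (ℓ : ℝ) = 2 / angle h * (angle h / 2 * ℓ) := by field_simp
      simp only [intervalSum, Finset.sum_const, Finset.card_range, nsmul_eq_mul, mul_one, pow_zero]
      rw [h2]
      exact mul_le_mul_of_nonneg_left h1 (by positivity)
  | succ k ih =>
    obtain ⟨T, hT, hb⟩ := ih (fun i => u i.castSucc)
    refine ⟨fun x => if |x - u (Fin.last (k + 1))| ≤ h then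
      (Finset.range (2 * h + 1)).biUnion fun i => (T (x - h + i)).image fun e => Fin.snoc e x
      else ∅, fun e he hs => ?_, ?_⟩
    · simp only [he (Fin.last (k + 1)), if_true, Finset.mem_biUnion, Finset.mem_range,
        Finset.mem_image]
      have h1 : |e (Fin.last k).castSucc - e (Fin.last (k + 1))| ≤ h := hs (Fin.last k)
      rw [abs_le] at h1
      refine ⟨(e (Fin.last k).castSucc - (e (Fin.last (k + 1)) - h)).toNat, by omega,
        Fin.init e, ?_, Fin.snoc_init_self e⟩
      rw [Int.toNat_of_nonneg (by omega), add_sub_cancel]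
      exact hT (Fin.init e) (fun i => he i.castSucc) (fun i => hs i.castSucc)
    · have hw := hb.window_le (by positivity)
      rw [pow_succ, ← mul_assoc]
      refine profileBound_of_le_indicator (u := u (Fin.last (k + 1)))
        (fun x => intervalSum_nonneg (by simp) _ _) hw (fun x => ?_)
      dsimp only
      split_ifs with hx
      · refine (Nat.cast_le.2 Finset.card_biUnion_le).trans ?_
        rw [Nat.cast_sum]
        exact Finset.sum_le_sum fun i _ => Nat.cast_le.2 Finset.card_image_le
      · simp

/-- An upper bound for the number of ways to add a row of `k + 1` vertices to a grid. -/
noncomputable def rowBound (h k : ℕ) : ℝ := growth h ^ k / angle h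

/-- Whatever the previous row `u`, the next row can be chosen in at most `rowBound h k` ways. -/
theorem exists_rows_card_le (h k : ℕ) (u : Fin (k + 1) → ℤ) :
    ∃ T : Finset (Fin (k + 1) → ℤ),
      (∀ e : Fin (k + 1) → ℤ, (∀ i, |e i - u i| ≤ h) →
        (∀ i : Fin k, |e i.castSucc - e i.succ| ≤ h) → e ∈ T) ∧
      (T.card : ℝ) ≤ rowBound h k := by
  classical
  obtain ⟨T, hT, hb⟩ := exists_rows_profileBound h k u
  refine ⟨(Finset.range (2 * h + 1)).biUnion fun i => T (u (Fin.last k) - h + i),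
    fun e he hs => ?_, ?_⟩
  · have h1 := he (Fin.last k)
    rw [abs_le] at h1
    refine Finset.mem_biUnion.2 ⟨(e (Fin.last k) - (u (Fin.last k) - h)).toNat,
      Finset.mem_range.2 (by omega), ?_⟩
    rw [Int.toNat_of_nonneg (by omega), add_sub_cancel]
    exact hT e he hs
  · have h1 := hb.2 (u (Fin.last k) - h) (2 * h + 1)
    rw [profile_full] at h1
    refine (Nat.cast_le.2 Finset.card_biUnion_le).trans ?_
    rw [Nat.cast_sum]
    refine h1.trans (le_of_eq ?_)
    unfold rowBound
    ring

theorem tendsto_angle_mul : Tendsto (fun h : ℕ => angle h * h) atTop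
    (𝓝 (Real.arctan (3 / 4) / 2)) := by
  have h1 : Tendsto (fun h : ℕ => (2 + 1 / (h : ℝ))) atTop (𝓝 (2 + 0)) :=
    tendsto_const_nhds.add tendsto_one_div_atTop_nhds_zero_nat
  rw [add_zero] at h1
  refine ((tendsto_const_nhds (x := Real.arctan (3 / 4))).div h1 two_ne_zero).congr' ?_
  filter_upwards [eventually_gt_atTop 0] with h hh
  have : (0 : ℝ) < h := by exact_mod_cast hh
  simp only [angle, Pi.div_apply]
  field_simp

theorem tendsto_growth_div : Tendsto (fun h : ℕ => growth h / h) atTop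
    (𝓝 (1 / Real.arctan (3 / 4))) := by
  have hω := arctan_three_div_four_pos
  have hθ : Tendsto angle atTop (𝓝[≠] 0) := by
    refine tendsto_nhdsWithin_iff.2 ⟨?_, Eventually.of_forall fun h => (angle_pos h).ne'⟩
    refine tendsto_const_nhds.div_atTop (tendsto_atTop_add_const_right _ _ ?_)
    exact tendsto_natCast_atTop_atTop.const_mul_atTop two_pos
  have hd : HasDerivAt (fun t : ℝ => Real.sin t + Real.cos t / 2) 1 0 := by
    refine ((Real.hasDerivAt_sin 0).add ((Real.hasDerivAt_cos 0).div_const 2)).congr_deriv ?_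
    simp
  have h1 := (hasDerivAt_iff_tendsto_slope_zero.1 hd).comp hθ
  have h2 := (((h1.mul tendsto_angle_mul).const_mul 2).inv₀ (by positivity))
  rw [show (2 * (1 * (Real.arctan (3 / 4) / 2)))⁻¹ = 1 / Real.arctan (3 / 4) by field_simp] at h2
  refine h2.congr' ?_
  filter_upwards [eventually_gt_atTop 0] with h hh
  have h3 : (0 : ℝ) < h := by exact_mod_cast hh
  have h4 := angle_pos h
  have h5 := profile_one_pos h
  have h6 : Real.sin (angle h) + Real.cos (angle h) / 2 - 1 / 2 = profile h 1 := by
    simp [profile]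
  simp only [Function.comp_apply, zero_add, Real.sin_zero, Real.cos_zero, smul_eq_mul, h6, growth]
  field_simp

theorem tendsto_rowBound_div (k : ℕ) :
    Tendsto (fun h : ℕ => rowBound h k / (h : ℝ) ^ (k + 1)) atTop
      (𝓝 (2 / Real.arctan (3 / 4) * (1 / Real.arctan (3 / 4)) ^ k)) := by
  have hω := arctan_three_div_four_pos
  have h1 := (tendsto_angle_mul.inv₀ (by positivity)).mul (tendsto_growth_div.pow k)
  rw [inv_div] at h1
  refine h1.congr fun h => ?_
  unfold rowBound
  rw [div_pow, mul_inv, pow_succ]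
  ring

/-! ### Lipschitz functions as lattice points of a polytope -/

open Classical in
/-- The function on all vertices with the value `0` at `v` and the given values elsewhere. -/
noncomputable def extendRoot {V : Type*} (v : V) (f : {x // x ≠ v} → ℝ) (x : V) : ℝ :=
  if hx : x = v then 0 else f ⟨x, hx⟩

/-- The polytope of the real-valued `1`-Lipschitz functions which vanish at the vertex `v`. -/
def lipPolytope {V : Type*} (G : SimpleGraph V) (v : V) : Set ({x // x ≠ v} → ℝ) :=
  {f | ∀ x y, G.Adj x y → |extendRoot v f x - extendRoot v f y| ≤ 1}

theorem continuous_extendRoot {V : Type*} (v x : V) :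
    Continuous fun f : {x // x ≠ v} → ℝ => extendRoot v f x := by
  unfold extendRoot
  split_ifs with hx
  · exact continuous_const
  · exact continuous_apply _

theorem extendRoot_self {V : Type*} (v : V) (f : {x // x ≠ v} → ℝ) : extendRoot v f v = 0 := by
  simp [extendRoot]

theorem extendRoot_coe {V : Type*} (v : V) (f : {x // x ≠ v} → ℝ) (x : {x // x ≠ v}) :
    extendRoot v f x = f x := by
  simp [extendRoot, x.2]

theorem isClosed_lipPolytope {V : Type*} (G : SimpleGraph V) (v : V) :
    IsClosed (lipPolytope G v) := by
  simp only [lipPolytope, Set.ofPred_forall]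
  refine isClosed_iInter fun x => isClosed_iInter fun y => isClosed_iInter fun _ => ?_
  exact isClosed_le ((continuous_extendRoot v x).sub (continuous_extendRoot v y)).abs
    continuous_const

theorem convex_lipPolytope {V : Type*} (G : SimpleGraph V) (v : V) :
    Convex ℝ (lipPolytope G v) := by
  intro f hf g hg a b ha hb hab x y hxy
  have e : ∀ z, extendRoot v (a • f + b • g) z = a * extendRoot v f z + b * extendRoot v g z := by
    intro z
    unfold extendRoot
    split_ifs <;> simp
  have h1 := abs_le.1 (hf x y hxy)
  have h2 := abs_le.1 (hg x y hxy)
  rw [e, e, abs_le]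
  constructor <;> nlinarith

theorem isBounded_lipPolytope {V : Type*} [Finite V] {G : SimpleGraph V} (hG : G.Connected)
    (v : V) : Bornology.IsBounded (lipPolytope G v) := by
  classical
  have := Fintype.ofFinite V
  have key : ∀ f ∈ lipPolytope G v, ∀ x y : V, ∀ w : G.Walk x y,
      |extendRoot v f x - extendRoot v f y| ≤ w.length := by
    intro f hf x y w
    induction w with
    | nil => simp
    | @cons a b c hab p ih =>
      have h1 := hf a b hab
      have h2 := abs_sub_le (extendRoot v f a) (extendRoot v f b) (extendRoot v f c)
      rw [SimpleGraph.Walk.length_cons]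
      push_cast
      linarith
  let B : {x // x ≠ v} → ℝ := fun x => ((hG.preconnected x v).some.length : ℝ)
  refine (Metric.isBounded_Icc (-B) B).subset fun f hf => ?_
  have h1 : ∀ x, |f x| ≤ B x := fun x => by
    have := key f hf x v (hG.preconnected x v).some
    rwa [extendRoot_self, extendRoot_coe, sub_zero] at this
  exact ⟨fun x => (abs_le.1 (h1 x)).1, fun x => (abs_le.1 (h1 x)).2⟩

theorem ncard_lip_const {V : Type*} {G : SimpleGraph V} (hG : G.Connected) (v : V) (h : ℕ) :
    (Lip G (fun _ => v) h).ncard = lipCount G h :=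
  ncard_lip_eq_lipCount G _
    (fun C => C.ind fun x => SimpleGraph.ConnectedComponent.sound (hG.preconnected v x)) h

theorem finite_lip_const {V : Type*} [Finite V] {G : SimpleGraph V} (hG : G.Connected) (v : V)
    (h : ℕ) : (Lip G (fun _ => v) h).Finite :=
  finite_lip G _
    (fun C => C.ind fun x => SimpleGraph.ConnectedComponent.sound (hG.preconnected v x)) h

theorem mem_lip_const {V : Type*} (G : SimpleGraph V) (v : V) (h : ℕ)
    (f : V → ℤ) :
    f ∈ Lip G (fun _ => v) h ↔ f v = 0 ∧ ∀ x y, G.Adj x y → |f x - f y| ≤ (h : ℤ) :=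
  and_congr_left fun _ => ⟨fun H => H (G.connectedComponentMk v), fun H _ => H⟩

open Pointwise in
/-- Dividing by `h` turns `h`-Lipschitz functions into the points of the polytope whose coordinates
lie in `h⁻¹ ℤ`. -/
theorem card_lattice_inter_lipPolytope {V : Type*} [Finite V] {G : SimpleGraph V}
    (hG : G.Connected) (v : V) {h : ℕ} (hh : 0 < h) :
    Nat.card ↑(lipPolytope G v ∩ ((h : ℝ)⁻¹ •
      (Submodule.span ℤ (Set.range (Pi.basisFun ℝ {x // x ≠ v})) : Set ({x // x ≠ v} → ℝ)))) =
      lipCount G h := by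
  have hpos : (0 : ℝ) < h := by exact_mod_cast hh
  rw [← ncard_lip_const hG v h, Nat.card_coe_set_eq]
  symm
  refine Set.ncard_congr (fun f _ x => (f x : ℝ) / h) ?_ ?_ ?_
  · intro f hf
    rw [mem_lip_const] at hf
    refine ⟨fun x y hxy => ?_, ?_⟩
    · have e : ∀ z, extendRoot v (fun x => (f x : ℝ) / h) z = (f z : ℝ) / h := by
        intro z
        unfold extendRoot
        split_ifs with hz
        · simp [hz, hf.1]
        · rfl
      rw [e, e, ← sub_div, abs_div, abs_of_pos hpos, div_le_one hpos]
      exact_mod_cast hf.2 x y hxy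
    · rw [Set.mem_inv_smul_set_iff₀ hpos.ne', SetLike.mem_coe,
        Module.Basis.mem_span_iff_repr_mem]
      intro x
      exact ⟨f x, by simp; field_simp⟩
  · intro f g hf hg hfg
    rw [mem_lip_const] at hf hg
    funext x
    by_cases hx : x = v
    · rw [hx, hf.1, hg.1]
    · have := congrFun hfg ⟨x, hx⟩
      simp only [div_left_inj' hpos.ne', Int.cast_inj] at this
      exact this
  · rintro g ⟨hg, hL⟩
    rw [Set.mem_inv_smul_set_iff₀ hpos.ne', SetLike.mem_coe,
        Module.Basis.mem_span_iff_repr_mem] at hL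
    choose m hm using hL
    have hm' : ∀ x, (m x : ℝ) = h * g x := fun x => by simpa using hm x
    classical
    have e : ∀ z, ((if hz : z = v then 0 else m ⟨z, hz⟩ : ℤ) : ℝ) = h * extendRoot v g z := by
      intro z
      unfold extendRoot
      split_ifs
      · simp
      · exact hm' _
    refine ⟨fun x => if hx : x = v then 0 else m ⟨x, hx⟩, ?_, ?_⟩
    · rw [mem_lip_const]
      refine ⟨by simp, fun x y hxy => ?_⟩
      have h1 := hg x y hxy
      rw [← Int.cast_le (R := ℝ), Int.cast_abs, Int.cast_sub, e, e, ← mul_sub, abs_mul,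
        abs_of_pos hpos, Int.cast_natCast]
      exact mul_le_of_le_one_right hpos.le h1
    · funext x
      rw [e, extendRoot_coe]
      field_simp

/-- Every function with values in `[0, h]` is `h`-Lipschitz; those with values in `[0, h)` away from
the root are enough for this bound. -/
theorem pow_le_lipCount {V : Type*} [Finite V] {G : SimpleGraph V} (hG : G.Connected) (h : ℕ) :
    h ^ (Nat.card V - 1) ≤ lipCount G h := by
  classical
  have := Fintype.ofFinite V
  obtain ⟨v⟩ := hG.nonempty
  rw [← ncard_lip_const hG v h]
  have h1 : Nat.card ({x // x ≠ v} → Fin h) = h ^ (Nat.card V - 1) := by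
    rw [Nat.card_fun, Nat.card_fin]
    congr 1
    simp [Fintype.card_subtype_compl]
  rw [← h1, ← Set.ncard_univ]
  refine Set.ncard_le_ncard_of_injOn
    (fun f x => if hx : x = v then 0 else ((f ⟨x, hx⟩ : ℕ) : ℤ)) ?_ ?_ (finite_lip_const hG v h)
  · intro f _
    rw [mem_lip_const]
    refine ⟨by simp, fun x y _ => ?_⟩
    rw [abs_le]
    split_ifs <;> constructor <;> omega
  · intro f _ g _ hfg
    funext x
    have := congrFun hfg x
    simpa [x.2, Fin.val_inj] using this

/-- The volume of the polytope of the `1`-Lipschitz functions, as a limit of lattice point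
counts. -/
theorem exists_tendsto_lipCount_div {V : Type*} [Finite V] {G : SimpleGraph V}
    (hG : G.Connected) : ∃ v : ℝ, 1 ≤ v ∧
      Tendsto (fun h : ℕ => (lipCount G h : ℝ) / (h : ℝ) ^ (Nat.card V - 1)) atTop (𝓝 v) := by
  classical
  have := Fintype.ofFinite V
  obtain ⟨r⟩ := hG.nonempty
  have h1 : Tendsto (fun h : ℕ => (lipCount G h : ℝ) / (h : ℝ) ^ (Nat.card V - 1)) atTop
      (𝓝 (MeasureTheory.volume.real (lipPolytope G r))) := by
    refine (tendsto_card_div_pow_atTop_volume (lipPolytope G r) (isBounded_lipPolytope hG r)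
      (isClosed_lipPolytope G r).measurableSet
      ((convex_lipPolytope G r).addHaar_frontier _)).congr' ?_
    filter_upwards [eventually_gt_atTop 0] with h hh
    rw [card_lattice_inter_lipPolytope hG r hh]
    congr 2
    simp [Fintype.card_subtype_compl]
  refine ⟨_, ge_of_tendsto h1 ?_, h1⟩
  filter_upwards [eventually_gt_atTop 0] with h hh
  have h3 : (0 : ℝ) < h := by exact_mod_cast hh
  rw [one_le_div (by positivity)]
  exact_mod_cast pow_le_lipCount hG h

/-! ### Gluing graphs along an edge -/

/-- If two connected graphs map onto a connected graph, and an edge joins their images, then a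
Lipschitz function is determined by its restrictions and by its difference along that edge. -/
theorem lipCount_le_mul {V V₁ V₂ : Type*} [Finite V₁] [Finite V₂] {G : SimpleGraph V}
    {G₁ : SimpleGraph V₁} {G₂ : SimpleGraph V₂} (hG : G.Connected) (hG₁ : G₁.Connected)
    (hG₂ : G₂.Connected) (i : G₁ →g G) (j : G₂ →g G)
    (hij : ∀ x, (∃ y, i y = x) ∨ ∃ y, j y = x) {a : V₁} {b : V₂} (hab : G.Adj (i a) (j b))
    (h : ℕ) : lipCount G h ≤ (2 * h + 1) * (lipCount G₁ h * lipCount G₂ h) := by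
  rw [← ncard_lip_const hG (i a), ← ncard_lip_const hG₁ a, ← ncard_lip_const hG₂ b]
  have hc : (Set.Icc (-(h : ℤ)) h).ncard = 2 * h + 1 := by
    rw [← Finset.coe_Icc, Set.ncard_coe_finset, Int.card_Icc]
    omega
  rw [← hc, ← Set.ncard_prod, ← Set.ncard_prod]
  refine Set.ncard_le_ncard_of_injOn
    (fun f => (f (j b), f ∘ i, fun x => f (j x) - f (j b))) ?_ ?_
    ((Set.finite_Icc _ _).prod ((finite_lip_const hG₁ a h).prod (finite_lip_const hG₂ b h)))
  · intro f hf
    rw [mem_lip_const] at hf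
    refine ⟨?_, ?_, ?_⟩
    · have := hf.2 _ _ hab
      rw [hf.1, zero_sub, abs_neg, abs_le] at this
      exact this
    · rw [mem_lip_const]
      exact ⟨hf.1, fun x y hxy => hf.2 _ _ (i.map_adj hxy)⟩
    · rw [mem_lip_const]
      refine ⟨by simp, fun x y hxy => ?_⟩
      simpa using hf.2 _ _ (j.map_adj hxy)
  · intro f _ g _ hfg
    simp only [Prod.mk.injEq] at hfg
    obtain ⟨h1, h2, h3⟩ := hfg
    funext x
    rcases hij x with ⟨y, rfl⟩ | ⟨y, rfl⟩
    · exact congrFun h2 y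
    · have := congrFun h3 y
      simp only [h1] at this
      linarith

theorem connected_gridGraph (m n : ℕ) : (gridGraph (m + 1) (n + 1)).Connected :=
  (SimpleGraph.pathGraph_connected m).boxProd (SimpleGraph.pathGraph_connected n)

/-- The factorwise map of box products. -/
def boxProdMap {α β γ δ : Type*} {G : SimpleGraph α} {H : SimpleGraph β} {G' : SimpleGraph γ}
    {H' : SimpleGraph δ} (f : G →g G') (g : H →g H') : G.boxProd H →g G'.boxProd H' where
  toFun := Prod.map f g
  map_rel' {x y} hxy := by
    rw [SimpleGraph.boxProd_adj] at hxy ⊢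
    rcases hxy with ⟨h1, h2⟩ | ⟨h1, h2⟩
    · exact Or.inl ⟨f.map_adj h1, congrArg g h2⟩
    · exact Or.inr ⟨g.map_adj h1, congrArg f h2⟩

/-- The path on `m` vertices as the beginning of the path on `m + k` vertices. -/
def pathCastAdd (m k : ℕ) : SimpleGraph.pathGraph m →g SimpleGraph.pathGraph (m + k) where
  toFun := Fin.castAdd k
  map_rel' {x y} hxy := by
    rw [SimpleGraph.pathGraph_adj] at hxy ⊢
    simpa using hxy

/-- The path on `k` vertices as the end of the path on `m + k` vertices. -/
def pathNatAdd (m k : ℕ) : SimpleGraph.pathGraph k →g SimpleGraph.pathGraph (m + k) where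
  toFun := Fin.natAdd m
  map_rel' {x y} hxy := by
    rw [SimpleGraph.pathGraph_adj] at hxy ⊢
    simp only [Fin.val_natAdd]
    omega

theorem path_cover (m k : ℕ) (x : Fin (m + k)) :
    (∃ y, pathCastAdd m k y = x) ∨ ∃ y, pathNatAdd m k y = x :=
  Fin.addCases (motive := fun x => (∃ y, pathCastAdd m k y = x) ∨ ∃ y, pathNatAdd m k y = x)
    (fun i => Or.inl ⟨i, rfl⟩) (fun i => Or.inr ⟨i, rfl⟩) x

theorem path_adj_joint (m k : ℕ) : (SimpleGraph.pathGraph (m + 1 + (k + 1))).Adj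
    (pathCastAdd (m + 1) (k + 1) (Fin.last m)) (pathNatAdd (m + 1) (k + 1) 0) := by
  rw [SimpleGraph.pathGraph_adj]
  left
  simp [pathCastAdd, pathNatAdd]

theorem lipCount_gridGraph_add_left (m k n h : ℕ) :
    lipCount (gridGraph (m + 1 + (k + 1)) (n + 1)) h ≤
      (2 * h + 1) * (lipCount (gridGraph (m + 1) (n + 1)) h *
        lipCount (gridGraph (k + 1) (n + 1)) h) := by
  have hG : (gridGraph (m + 1 + (k + 1)) (n + 1)).Connected := connected_gridGraph (m + 1 + k) n
  refine lipCount_le_mul hG (connected_gridGraph m n)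
    (connected_gridGraph k n) (boxProdMap (pathCastAdd _ _) SimpleGraph.Hom.id)
    (boxProdMap (pathNatAdd _ _) SimpleGraph.Hom.id) ?_ (a := (Fin.last m, 0)) (b := (0, 0)) ?_ h
  · rintro ⟨x, y⟩
    rcases path_cover _ _ x with ⟨z, rfl⟩ | ⟨z, rfl⟩
    · exact Or.inl ⟨(z, y), rfl⟩
    · exact Or.inr ⟨(z, y), rfl⟩
  · exact SimpleGraph.boxProd_adj.2 (Or.inl ⟨path_adj_joint m k, rfl⟩)

theorem lipCount_gridGraph_add_right (m n k h : ℕ) :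
    lipCount (gridGraph (m + 1) (n + 1 + (k + 1))) h ≤
      (2 * h + 1) * (lipCount (gridGraph (m + 1) (n + 1)) h *
        lipCount (gridGraph (m + 1) (k + 1)) h) := by
  have hG : (gridGraph (m + 1) (n + 1 + (k + 1))).Connected := connected_gridGraph m (n + 1 + k)
  refine lipCount_le_mul hG (connected_gridGraph m n)
    (connected_gridGraph m k) (boxProdMap SimpleGraph.Hom.id (pathCastAdd _ _))
    (boxProdMap SimpleGraph.Hom.id (pathNatAdd _ _)) ?_ (a := (0, Fin.last n)) (b := (0, 0)) ?_ h
  · rintro ⟨y, x⟩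
    rcases path_cover _ _ x with ⟨z, rfl⟩ | ⟨z, rfl⟩
    · exact Or.inl ⟨(y, z), rfl⟩
    · exact Or.inr ⟨(y, z), rfl⟩
  · exact SimpleGraph.boxProd_adj.2 (Or.inr ⟨path_adj_joint n k, rfl⟩)

/-- Adding a row: each function on the smaller grid extends in at most `rowBound h n` ways. -/
theorem lipCount_gridGraph_succ_le (m n h : ℕ) :
    (lipCount (gridGraph (m + 2) (n + 1)) h : ℝ) ≤
      lipCount (gridGraph (m + 1) (n + 1)) h * rowBound h n := by
  classical
  have hG := connected_gridGraph (m + 1) n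
  have hG' := connected_gridGraph m n
  rw [← ncard_lip_const hG (0, 0), ← ncard_lip_const hG' (0, 0)]
  have hfin := finite_lip_const hG' (0, 0) h
  choose T hT hTc using fun u : Fin (n + 1) → ℤ => exists_rows_card_le h n u
  let S := hfin.toFinset.sigma fun f => T fun y => f (Fin.last m, y)
  have h1 : (Lip (gridGraph (m + 2) (n + 1)) (fun _ => (0, 0)) h).ncard ≤ S.card := by
    rw [← Set.ncard_coe_finset]
    refine Set.ncard_le_ncard_of_injOn
      (fun f => ⟨fun p => f (p.1.castSucc, p.2), fun y => f (Fin.last (m + 1), y)⟩) ?_ ?_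
      (Finset.finite_toSet _)
    · intro f hf
      rw [mem_lip_const] at hf
      obtain ⟨hf0, hf1⟩ := hf
      simp only [S, Finset.coe_sigma, Set.mem_sigma_iff, Finset.mem_coe, Set.Finite.mem_toFinset]
      refine ⟨?_, hT _ _ (fun y => ?_) fun y => ?_⟩
      · rw [mem_lip_const]
        refine ⟨hf0, fun x y hxy => hf1 _ _ ?_⟩
        exact (boxProdMap (pathCastAdd (m + 1) 1) SimpleGraph.Hom.id).map_adj hxy
      · refine hf1 _ _ (SimpleGraph.boxProd_adj.2 (Or.inl ⟨?_, rfl⟩))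
        rw [SimpleGraph.pathGraph_adj]
        right
        simp
      · refine hf1 _ _ (SimpleGraph.boxProd_adj.2 (Or.inr ⟨?_, rfl⟩))
        rw [SimpleGraph.pathGraph_adj]
        left
        simp
    · intro f _ g _ hfg
      simp only [Sigma.mk.injEq, heq_eq_eq] at hfg
      funext ⟨x, y⟩
      refine Fin.lastCases ?_ (fun i => ?_) x
      · exact congrFun hfg.2 y
      · exact congrFun hfg.1 (i, y)
  refine (Nat.cast_le.2 h1).trans ?_
  rw [Finset.card_sigma, Nat.cast_sum, Set.ncard_eq_toFinset_card _ hfin, ← nsmul_eq_mul]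
  exact Finset.sum_le_card_nsmul _ _ _ fun f _ => hTc _

theorem tendsto_lipRatio {V : Type*} [Finite V] {G : SimpleGraph V} (hG : G.Connected)
    (hV : 2 ≤ Nat.card V) {v : ℝ}
    (hv : Tendsto (fun h : ℕ => (lipCount G h : ℝ) / (h : ℝ) ^ (Nat.card V - 1)) atTop (𝓝 v)) :
    Tendsto (lipRatio G) atTop (𝓝 (v ^ (1 / ((Nat.card V : ℝ) - 1)))) := by
  have hp : (0 : ℝ) < (Nat.card V : ℝ) - 1 := by
    have : (2 : ℝ) ≤ Nat.card V := by exact_mod_cast hV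
    linarith
  refine (hv.rpow_const (p := 1 / ((Nat.card V : ℝ) - 1)) (Or.inr (by positivity))).congr' ?_
  filter_upwards [eventually_gt_atTop 0] with h hh
  have hc : Nat.card G.ConnectedComponent = 1 := by
    have := hG.preconnected.subsingleton_connectedComponent
    obtain ⟨x⟩ := hG.nonempty
    have : Nonempty G.ConnectedComponent := ⟨G.connectedComponentMk x⟩
    exact Nat.card_unique
  have hpow : ((h : ℝ) ^ (Nat.card V - 1)) ^ (1 / ((Nat.card V : ℝ) - 1)) = h := by
    have e : (Nat.card V : ℝ) - 1 = ((Nat.card V - 1 : ℕ) : ℝ) := by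
      rw [Nat.cast_sub (by omega), Nat.cast_one]
    rw [e, one_div]
    exact Real.pow_rpow_inv_natCast (Nat.cast_nonneg h) (by omega)
  rw [lipRatio, hc, Nat.cast_one, Real.div_rpow (Nat.cast_nonneg _) (by positivity), hpow]
  ring

/-- The volume of the polytope of the real-valued `1`-Lipschitz functions on the `m × n` grid which
vanish at one vertex. -/
noncomputable def gridVolume (m n : ℕ) : ℝ :=
  limUnder atTop fun h : ℕ => (lipCount (gridGraph m n) h : ℝ) / (h : ℝ) ^ (m * n - 1)

theorem connected_gridGraph_of_pos {m n : ℕ} (hm : 0 < m) (hn : 0 < n) :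
    (gridGraph m n).Connected := by
  obtain ⟨m, rfl⟩ := Nat.exists_eq_add_one.2 hm
  obtain ⟨n, rfl⟩ := Nat.exists_eq_add_one.2 hn
  exact connected_gridGraph m n

theorem gridVolume_spec {m n : ℕ} (hm : 0 < m) (hn : 0 < n) : 1 ≤ gridVolume m n ∧
    Tendsto (fun h : ℕ => (lipCount (gridGraph m n) h : ℝ) / (h : ℝ) ^ (m * n - 1)) atTop
      (𝓝 (gridVolume m n)) := by
  obtain ⟨v, hv1, hv⟩ := exists_tendsto_lipCount_div (connected_gridGraph_of_pos hm hn)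
  rw [Nat.card_prod, Nat.card_fin, Nat.card_fin] at hv
  have : gridVolume m n = v := hv.limUnder_eq
  rw [this]
  exact ⟨hv1, hv⟩

/-- The passage from lattice point counts to volumes in a gluing inequality. -/
theorem gridVolume_le_of_lipCount_le {m n m₁ n₁ m₂ n₂ : ℕ} (hm : 0 < m) (hn : 0 < n)
    (hm₁ : 0 < m₁) (hn₁ : 0 < n₁) (hm₂ : 0 < m₂) (hn₂ : 0 < n₂)
    (hcard : m * n = m₁ * n₁ + m₂ * n₂)
    (hle : ∀ h, lipCount (gridGraph m n) h ≤
      (2 * h + 1) * (lipCount (gridGraph m₁ n₁) h * lipCount (gridGraph m₂ n₂) h)) :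
    gridVolume m n ≤ 2 * (gridVolume m₁ n₁ * gridVolume m₂ n₂) := by
  have h2 : Tendsto (fun h : ℕ => (2 + 1 / (h : ℝ))) atTop (𝓝 (2 + 0)) :=
    tendsto_const_nhds.add tendsto_one_div_atTop_nhds_zero_nat
  rw [add_zero] at h2
  refine le_of_tendsto_of_tendsto (gridVolume_spec hm hn).2
    (h2.mul ((gridVolume_spec hm₁ hn₁).2.mul (gridVolume_spec hm₂ hn₂).2)) ?_
  filter_upwards [eventually_gt_atTop 0] with h hh
  have h0 : (0 : ℝ) < h := by exact_mod_cast hh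
  have p₁ := Nat.mul_pos hm₁ hn₁
  have p₂ := Nat.mul_pos hm₂ hn₂
  have e : m * n - 1 = 1 + (m₁ * n₁ - 1) + (m₂ * n₂ - 1) := by omega
  have h3 : (lipCount (gridGraph m n) h : ℝ) ≤
      (2 * h + 1) * (lipCount (gridGraph m₁ n₁) h * lipCount (gridGraph m₂ n₂) h) := by
    exact_mod_cast hle h
  rw [e, pow_add, pow_add, pow_one]
  refine (div_le_div_of_nonneg_right h3 (by positivity)).trans (le_of_eq ?_)
  field_simp

theorem gridVolume_add_left {m k n : ℕ} (hm : 0 < m) (hk : 0 < k) (hn : 0 < n) :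
    gridVolume (m + k) n ≤ 2 * (gridVolume m n * gridVolume k n) := by
  refine gridVolume_le_of_lipCount_le (by omega) hn hm hn hk hn (add_mul m k n) fun h => ?_
  obtain ⟨m, rfl⟩ := Nat.exists_eq_add_one.2 hm
  obtain ⟨k, rfl⟩ := Nat.exists_eq_add_one.2 hk
  obtain ⟨n, rfl⟩ := Nat.exists_eq_add_one.2 hn
  exact lipCount_gridGraph_add_left m k n h

theorem gridVolume_add_right {m n k : ℕ} (hm : 0 < m) (hn : 0 < n) (hk : 0 < k) :
    gridVolume m (n + k) ≤ 2 * (gridVolume m n * gridVolume m k) := by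
  refine gridVolume_le_of_lipCount_le hm (by omega) hm hn hm hk (mul_add m n k) fun h => ?_
  obtain ⟨m, rfl⟩ := Nat.exists_eq_add_one.2 hm
  obtain ⟨k, rfl⟩ := Nat.exists_eq_add_one.2 hk
  obtain ⟨n, rfl⟩ := Nat.exists_eq_add_one.2 hn
  exact lipCount_gridGraph_add_right m n k h

theorem gridVolume_succ_le (m n : ℕ) :
    gridVolume (m + 2) (n + 1) ≤ gridVolume (m + 1) (n + 1) *
      (2 / Real.arctan (3 / 4) * (1 / Real.arctan (3 / 4)) ^ n) := by
  refine le_of_tendsto_of_tendsto (gridVolume_spec (by omega) (by omega)).2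
    ((gridVolume_spec (by omega) (by omega)).2.mul (tendsto_rowBound_div n)) ?_
  filter_upwards with h
  have e : (m + 2) * (n + 1) - 1 = ((m + 1) * (n + 1) - 1) + (n + 1) := by
    have : 0 < (m + 1) * (n + 1) := by positivity
    have : (m + 2) * (n + 1) = (m + 1) * (n + 1) + (n + 1) := by ring
    omega
  rw [e, pow_add, div_mul_div_comm]
  exact div_le_div_of_nonneg_right (lipCount_gridGraph_succ_le m n h) (by positivity)

/-- A grid is built row by row from its first row. -/
theorem gridVolume_le_mul_pow (m n : ℕ) :
    gridVolume (m + 1) (n + 1) ≤ gridVolume 1 (n + 1) *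
      (2 / Real.arctan (3 / 4) * (1 / Real.arctan (3 / 4)) ^ n) ^ m := by
  have hω := arctan_three_div_four_pos
  induction m with
  | zero => simp
  | succ m ih =>
    refine (gridVolume_succ_le m n).trans ?_
    refine (mul_le_mul_of_nonneg_right ih (by positivity)).trans (le_of_eq ?_)
    rw [pow_succ, mul_assoc]

/-! ### Subadditivity in two variables -/

section Fekete

variable {a : ℕ → ℕ → ℝ}

theorem subadditive_mul_add_le {f : ℕ → ℝ}
    (hf : ∀ m k, 0 < m → 0 < k → f (m + k) ≤ f m + f k) {k r : ℕ} (hk : 0 < k) (hr : 0 < r)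
    (q : ℕ) : f (q * k + r) ≤ q * f k + f r := by
  induction q with
  | zero => simp
  | succ q ih =>
    have h1 := hf k (q * k + r) hk (by omega)
    rw [show (q + 1) * k + r = k + (q * k + r) by ring]
    push_cast
    linarith

theorem biSubadditive_le (h1 : ∀ m k n, 0 < m → 0 < k → 0 < n → a (m + k) n ≤ a m n + a k n)
    (h2 : ∀ m n k, 0 < m → 0 < n → 0 < k → a m (n + k) ≤ a m n + a m k) {m n : ℕ} (hm : 0 < m)
    (hn : 0 < n) : a m n ≤ m * n * a 1 1 := by
  obtain ⟨m, rfl⟩ := Nat.exists_eq_add_one.2 hm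
  obtain ⟨n, rfl⟩ := Nat.exists_eq_add_one.2 hn
  have e1 := subadditive_mul_add_le (f := fun m => a m (n + 1))
    (fun m k hm hk => h1 m k _ hm hk hn) one_pos one_pos m
  have e2 := subadditive_mul_add_le (f := fun n => a 1 n)
    (fun n k hn hk => h2 1 n k one_pos hn hk) one_pos one_pos n
  simp only [mul_one] at e1 e2
  push_cast
  have : (0 : ℝ) ≤ m := Nat.cast_nonneg m
  nlinarith

/-- Fekete's lemma for squares: a nonnegative function of two positive integers which is
subadditive in each of them grows on the diagonal like a multiple of `n ^ 2`. -/
theorem exists_tendsto_diag_of_biSubadditive (h0 : ∀ m n, 0 < m → 0 < n → 0 ≤ a m n)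
    (h1 : ∀ m k n, 0 < m → 0 < k → 0 < n → a (m + k) n ≤ a m n + a k n)
    (h2 : ∀ m n k, 0 < m → 0 < n → 0 < k → a m (n + k) ≤ a m n + a m k) :
    ∃ l : ℝ, Tendsto (fun n : ℕ => a n n / (n : ℝ) ^ 2) atTop (𝓝 l) := by
  set S : Set ℝ := (fun n : ℕ => a n n / (n : ℝ) ^ 2) '' Set.Ici 1 with hS
  have hbdd : BddBelow S := by
    refine ⟨0, ?_⟩
    rintro _ ⟨n, hn, rfl⟩
    exact div_nonneg (h0 n n hn hn) (by positivity)
  have hne : S.Nonempty := ⟨_, 1, Set.mem_Ici.2 le_rfl, rfl⟩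
  refine ⟨sInf S, tendsto_order.2 ⟨fun b hb => ?_, fun b hb => ?_⟩⟩
  · filter_upwards [eventually_ge_atTop 1] with n hn
    exact hb.trans_le (csInf_le hbdd ⟨n, hn, rfl⟩)
  · obtain ⟨_, ⟨k, hk, rfl⟩, hkb⟩ := exists_lt_of_csInf_lt hne hb
    have hk : 0 < k := hk
    have hlim : Tendsto (fun n : ℕ => a k k / (k : ℝ) ^ 2 + 2 * a 1 1 * k * (1 / (n : ℝ))) atTop
        (𝓝 (a k k / (k : ℝ) ^ 2 + 2 * a 1 1 * k * 0)) :=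
      tendsto_const_nhds.add (tendsto_one_div_atTop_nhds_zero_nat.const_mul _)
    rw [mul_zero, add_zero] at hlim
    filter_upwards [hlim.eventually_lt_const hkb, eventually_ge_atTop 1] with n hn hn1
    refine lt_of_le_of_lt ?_ hn
    -- The remainder `r` runs over `1, ..., k` since subadditivity is only known for positive
    -- arguments. The `q ^ 2` squares of side `k` give the main term, the rest is `O(n)`.
    obtain ⟨q, r, hr, hrk, hqr⟩ : ∃ q r, 0 < r ∧ r ≤ k ∧ n = q * k + r :=
      ⟨(n - 1) / k, (n - 1) % k + 1, by omega, Nat.mod_lt _ hk, by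
        have := Nat.div_add_mod' (n - 1) k
        omega⟩
    have e1 := subadditive_mul_add_le (f := fun m => a m n)
      (fun m k hm hk => h1 m k _ hm hk hn1) hk hr q
    have e2 := subadditive_mul_add_le (f := fun n => a k n)
      (fun n l hn hl => h2 k n l hk hn hl) hk hr q
    have e3 := biSubadditive_le h1 h2 hk hr
    have e4 := biSubadditive_le h1 h2 hr hn1
    simp only [← hqr] at e1 e2
    have c0 := h0 1 1 one_pos one_pos
    have ck := h0 k k hk hk
    have hqr' : (n : ℝ) = q * k + r := by exact_mod_cast hqr
    have hr' : (r : ℝ) ≤ k := by exact_mod_cast hrk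
    have hr0 : (0 : ℝ) ≤ r := Nat.cast_nonneg r
    have hq0 : (0 : ℝ) ≤ q := Nat.cast_nonneg q
    have hk0 : (0 : ℝ) < k := by exact_mod_cast hk
    have hn0 : (0 : ℝ) < n := by exact_mod_cast hn1
    have b1 : a n n ≤ q * (q * a k k + k * r * a 1 1) + r * n * a 1 1 := by
      have := mul_le_mul_of_nonneg_left (e2.trans (add_le_add_right e3 _)) hq0
      linarith
    have b2 : (q : ℝ) * k ≤ n := by linarith
    have b3 : (q : ℝ) * k * (r * a 1 1) ≤ n * (k * a 1 1) := by gcongr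
    have b4 : (r : ℝ) * n * a 1 1 ≤ k * n * a 1 1 := by gcongr
    have b5 : (q : ℝ) ^ 2 * a k k ≤ (n / k) ^ 2 * a k k := by
      gcongr
      rwa [le_div_iff₀ hk0]
    rw [div_le_iff₀ (by positivity)]
    calc a n n ≤ (n / k) ^ 2 * a k k + 2 * (n * (k * a 1 1)) := by nlinarith
      _ = _ := by field_simp

end Fekete

/-! ### The constants of the square grids -/

/-- The logarithm `log (2 * gridVolume m n)`; the factor `2` accounts for the edge used in a
gluing, which makes this subadditive in each argument. -/
noncomputable def gridEntropy (m n : ℕ) : ℝ := Real.log (2 * gridVolume m n)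

theorem gridEntropy_nonneg {m n : ℕ} (hm : 0 < m) (hn : 0 < n) : 0 ≤ gridEntropy m n :=
  Real.log_nonneg (by linarith [(gridVolume_spec hm hn).1])

theorem log_two_mul_le {x y z : ℝ} (hx : 1 ≤ x) (hy : 1 ≤ y) (hz : 1 ≤ z)
    (hle : x ≤ 2 * (y * z)) : Real.log (2 * x) ≤ Real.log (2 * y) + Real.log (2 * z) := by
  rw [← Real.log_mul (by positivity) (by positivity)]
  exact Real.log_le_log (by positivity) (by linarith)

theorem gridEntropy_add_left (m k n : ℕ) (hm : 0 < m) (hk : 0 < k) (hn : 0 < n) :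
    gridEntropy (m + k) n ≤ gridEntropy m n + gridEntropy k n :=
  log_two_mul_le (gridVolume_spec (by omega) hn).1 (gridVolume_spec hm hn).1
    (gridVolume_spec hk hn).1 (gridVolume_add_left hm hk hn)

theorem gridEntropy_add_right (m n k : ℕ) (hm : 0 < m) (hn : 0 < n) (hk : 0 < k) :
    gridEntropy m (n + k) ≤ gridEntropy m n + gridEntropy m k :=
  log_two_mul_le (gridVolume_spec hm (by omega)).1 (gridVolume_spec hm hn).1
    (gridVolume_spec hm hk).1 (gridVolume_add_right hm hn hk)

theorem gridEntropy_diag_le {n : ℕ} (hn : 0 < n) :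
    gridEntropy n n / (n : ℝ) ^ 2 ≤ Real.log (1 / Real.arctan (3 / 4)) +
      (gridEntropy 1 1 + Real.log (2 / Real.arctan (3 / 4))) * (1 / (n : ℝ)) := by
  have hω := arctan_three_div_four_pos
  have hω1 := arctan_three_div_four_le
  have h1 : 0 ≤ Real.log (1 / Real.arctan (3 / 4)) :=
    Real.log_nonneg ((one_le_div hω).2 (by linarith))
  have h2 : 0 ≤ Real.log (2 / Real.arctan (3 / 4)) :=
    Real.log_nonneg ((one_le_div hω).2 (by linarith))
  have h3 := biSubadditive_le gridEntropy_add_left gridEntropy_add_right one_pos hn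
  obtain ⟨n, rfl⟩ := Nat.exists_eq_add_one.2 hn
  have h4 : gridEntropy (n + 1) (n + 1) ≤ gridEntropy 1 (n + 1) +
      n * (Real.log (2 / Real.arctan (3 / 4)) + n * Real.log (1 / Real.arctan (3 / 4))) := by
    have p1 := (gridVolume_spec hn hn).1
    have p2 := (gridVolume_spec one_pos hn).1
    have := gridVolume_le_mul_pow n n
    unfold gridEntropy
    rw [← Real.log_pow, ← Real.log_mul (by positivity) (by positivity), ← Real.log_pow,
      ← Real.log_mul (by positivity) (by positivity)]
    exact Real.log_le_log (by positivity) (by linarith)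
  have hn0 : (0 : ℝ) ≤ n := Nat.cast_nonneg n
  push_cast at h3 ⊢
  rw [div_le_iff₀ (by positivity)]
  have e : (Real.log (1 / Real.arctan (3 / 4)) +
      (gridEntropy 1 1 + Real.log (2 / Real.arctan (3 / 4))) * (1 / ((n : ℝ) + 1))) *
      ((n : ℝ) + 1) ^ 2 = Real.log (1 / Real.arctan (3 / 4)) * ((n : ℝ) + 1) ^ 2 +
      (gridEntropy 1 1 + Real.log (2 / Real.arctan (3 / 4))) * ((n : ℝ) + 1) := by
    field_simp
  rw [e]
  nlinarith [mul_nonneg hn0 h1]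

theorem tendsto_lipRatio_gridGraph {n : ℕ} (hn : 2 ≤ n) :
    Tendsto (lipRatio (gridGraph n n)) atTop
      (𝓝 (gridVolume n n ^ (1 / ((n : ℝ) ^ 2 - 1)))) := by
  have hc : Nat.card (Fin n × Fin n) = n * n := by simp
  have h1 := tendsto_lipRatio (connected_gridGraph_of_pos (by omega : 0 < n) (by omega : 0 < n))
    (by rw [hc]; nlinarith) (by rw [hc]; exact (gridVolume_spec (by omega) (by omega)).2)
  rwa [hc, Nat.cast_mul, ← sq] at h1

/-- The constant of the square grid in terms of quantities with known limits: numerator and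
denominator of the exponent `log (gridVolume n n) / (n ^ 2 - 1)` are divided by `n ^ 2`. -/
theorem lipConst_gridGraph {n : ℕ} (hn : 2 ≤ n) :
    lipConst (gridGraph n n) = Real.exp
      ((gridEntropy n n / (n : ℝ) ^ 2 - Real.log 2 * (1 / (n : ℝ)) ^ 2) /
        (1 - (1 / (n : ℝ)) ^ 2)) := by
  have h1 := (gridVolume_spec (by omega : 0 < n) (by omega : 0 < n)).1
  have hn' : (2 : ℝ) ≤ n := by exact_mod_cast hn
  have h2 : (0 : ℝ) < (n : ℝ) ^ 2 - 1 := by nlinarith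
  rw [lipConst, (tendsto_lipRatio_gridGraph hn).limUnder_eq, Real.rpow_def_of_pos (by positivity),
    gridEntropy, Real.log_mul (by norm_num) (by positivity)]
  congr 1
  have h3 : (1 - (1 / (n : ℝ)) ^ 2) = ((n : ℝ) ^ 2 - 1) / (n : ℝ) ^ 2 := by field_simp
  rw [h3]
  field_simp
  ring

/-! ### The numerical value -/

/-- The Taylor polynomials of `arctan` of degrees `7` and `5` are lower and upper bounds. -/
theorem arctan_bounds {x : ℝ} (hx : 0 ≤ x) :
    x - x ^ 3 / 3 + x ^ 5 / 5 - x ^ 7 / 7 ≤ Real.arctan x ∧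
      Real.arctan x ≤ x - x ^ 3 / 3 + x ^ 5 / 5 := by
  have hp : ∀ y : ℝ, HasDerivAt (fun y : ℝ => y - y ^ 3 / 3 + y ^ 5 / 5)
      (1 - y ^ 2 + y ^ 4) y := by
    intro y
    refine (((hasDerivAt_id y).sub ((hasDerivAt_pow 3 y).div_const 3)).add
      ((hasDerivAt_pow 5 y).div_const 5)).congr_deriv ?_
    norm_num
  have h1 : Monotone fun y : ℝ => y - y ^ 3 / 3 + y ^ 5 / 5 - Real.arctan y := by
    refine monotone_of_hasDerivAt_nonneg (fun y => (hp y).sub (Real.hasDerivAt_arctan y)) ?_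
    intro y
    have : 1 - y ^ 2 + y ^ 4 - 1 / (1 + y ^ 2) = y ^ 6 / (1 + y ^ 2) := by field_simp; ring
    simp only [Pi.zero_apply, this]
    positivity
  have h2 : Monotone fun y : ℝ => Real.arctan y - (y - y ^ 3 / 3 + y ^ 5 / 5 - y ^ 7 / 7) := by
    refine monotone_of_hasDerivAt_nonneg (fun y => (Real.hasDerivAt_arctan y).sub
      ((hp y).sub ((hasDerivAt_pow 7 y).div_const 7))) ?_
    intro y
    have : 1 / (1 + y ^ 2) - (1 - y ^ 2 + y ^ 4 - y ^ 6) = y ^ 8 / (1 + y ^ 2) := by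
      field_simp; ring
    have e : (7 : ℕ) * y ^ (7 - 1) / 7 = y ^ 6 := by norm_num
    simp only [Pi.zero_apply, e, this]
    positivity
  have g1 := h1 hx
  have g2 := h2 hx
  norm_num at g1 g2
  constructor <;> linarith

theorem abs_one_div_arctan_sub_lt : |1 / Real.arctan (3 / 4) - 1.554| < 0.0005 := by
  have h : Real.arctan (3 / 4) = 2 * Real.arctan (1 / 3) := by
    rw [Real.two_mul_arctan (by norm_num) (by norm_num)]
    norm_num
  obtain ⟨h1, h2⟩ := arctan_bounds (x := 1 / 3) (by norm_num)
  norm_num at h1 h2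
  have hω := arctan_three_div_four_pos
  have l1 : 1 / Real.arctan (3 / 4) < 1.5545 := by
    rw [div_lt_iff₀ hω, h]; linarith
  have l2 : 1.5535 < 1 / Real.arctan (3 / 4) := by
    rw [lt_div_iff₀ hω, h]; linarith
  rw [abs_lt]
  constructor <;> linarith

end LipGraph

theorem theorem2p1p4 :
    -- each constant `c(L_{n,n})` is a genuine limit
    (∀ n : ℕ, 2 ≤ n → Tendsto (LipGraph.lipRatio (LipGraph.gridGraph n n)) atTop
      (𝓝 (LipGraph.lipConst (LipGraph.gridGraph n n)))) ∧
    -- these constants converge, and the limit obeys the bound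
    (∃ L : ℝ, Tendsto (fun n : ℕ => LipGraph.lipConst (LipGraph.gridGraph n n)) atTop (𝓝 L) ∧
      L ≤ 1 / Real.arctan (3 / 4)) ∧
    -- the numerical value of the bound, to three decimals
    |1 / Real.arctan (3 / 4) - 1.554| < 0.0005 := by
  open LipGraph in
  refine ⟨fun n hn => ?_, ?_, abs_one_div_arctan_sub_lt⟩
  · have h1 := tendsto_lipRatio_gridGraph hn
    rwa [lipConst, h1.limUnder_eq]
  obtain ⟨l, hl⟩ := exists_tendsto_diag_of_biSubadditive
    (fun m n hm hn => gridEntropy_nonneg hm hn) gridEntropy_add_left gridEntropy_add_right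
  have hω := arctan_three_div_four_pos
  have hz := tendsto_one_div_atTop_nhds_zero_nat (𝕜 := ℝ)
  refine ⟨Real.exp l, ?_, ?_⟩
  · have h1 := (hl.sub ((hz.pow 2).const_mul (Real.log 2))).div
      ((tendsto_const_nhds (x := (1 : ℝ))).sub (hz.pow 2)) (by norm_num)
    rw [show (l - Real.log 2 * 0 ^ 2) / (1 - 0 ^ 2) = l by norm_num] at h1
    refine ((Real.continuous_exp.tendsto l).comp h1).congr' ?_
    filter_upwards [eventually_ge_atTop 2] with n hn
    exact (lipConst_gridGraph hn).symm
  · have h2 := (tendsto_const_nhds (x := Real.log (1 / Real.arctan (3 / 4)))).add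
      (hz.const_mul (gridEntropy 1 1 + Real.log (2 / Real.arctan (3 / 4))))
    rw [mul_zero, add_zero] at h2
    rw [← Real.exp_log (show 0 < 1 / Real.arctan (3 / 4) by positivity)]
    refine Real.exp_le_exp.2 (le_of_tendsto_of_tendsto hl h2 ?_)
    filter_upwards [eventually_gt_atTop 0] with n hn
    exact gridEntropy_diag_le hn
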